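/- Let $G$ be a compact metrizable abelian group and let $\tau\colon G\to G$, $\tau(x)=ax$, be a translation that is minimal, i.e. every orbit $\{\tau^k x: k\in\mathbb Z\}$ is dense in $G$. Let $C(G)$ be the Banach space of real continuous functions on $G$ with the supremum norm. (1) $\tau$ is topologically simple: the smallest cardinality of a set $F\subset C(G)$ such that the real linear span of $\{f\circ\tau^k: f\in F,\ k\in\mathbb Z\}$ is dense in $C(G)$ equals $1$. (2) Let $\lambda$ be the Haar probability measure on $G$ and let $\hat G$ be the group of continuous characters of $G$. If $f\in C(G)$ satisfies $\hat f(\chi)=\int_G f\,\overline{\chi}\,d\lambda\neq 0$ for every $\chi\in\hat G$, then $f$ is a cyclic vector: the real linear span of $\{f\circ\tau^k: k\in\mathbb Z\}$ is dense in $C(G)$; moreover already the real linear span of $\{f\circ\tau^k: k\in\mathbb N\}$ is dense in $C(G)$. -/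

import Mathlib

open MeasureTheory
open scoped ComplexConjugate

/-- The closed subspace `V_F^U`: the closure of the linear span of all `U ^ k x` with `k ∈ ℤ` and
`x ∈ F`. -/
def orbitClosedSpan {E : Type*} [NormedAddCommGroup E] [NormedSpace ℝ E]
    (U : E ≃L[ℝ] E) (F : Set E) : Submodule ℝ E :=
  (Submodule.span ℝ {y | ∃ k : ℤ, ∃ x ∈ F, y = (U ^ k) x}).topologicalClosure

/-- `F` is a generating family of the invertible bounded operator `U`. -/
def IsGeneratingFamily {E : Type*} [NormedAddCommGroup E] [NormedSpace ℝ E]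
    (U : E ≃L[ℝ] E) (F : Set E) : Prop :=
  orbitClosedSpan U F = ⊤

/-- The multiplicity of `U`: the smallest cardinality (in `ℕ ∪ {∞}`) of a generating family.
It is `0` when `E = 0`, because the empty family is then generating. -/
noncomputable def operatorMultiplicity {E : Type*} [NormedAddCommGroup E] [NormedSpace ℝ E]
    (U : E ≃L[ℝ] E) : ℕ∞ :=
  ⨅ F ∈ {F : Set E | IsGeneratingFamily U F}, F.encard

/-- The composition operator `φ ↦ φ ∘ T` on the real Banach space `C(X)` (sup norm). -/
def compositionOperator {X : Type*} [TopologicalSpace X] [CompactSpace X] (T : X ≃ₜ X) :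
    C(X, ℝ) ≃L[ℝ] C(X, ℝ) where
  toFun φ := φ.comp (T : C(X, X))
  invFun φ := φ.comp (T.symm : C(X, X))
  map_add' _ _ := rfl
  map_smul' _ _ := rfl
  left_inv φ := by ext x; simp
  right_inv φ := by ext x; simp
  continuous_toFun := ContinuousMap.continuous_precomp _
  continuous_invFun := ContinuousMap.continuous_precomp _

/-- The topological multiplicity of the system `(X, T)`. -/
noncomputable def topologicalMultiplicity {X : Type*} [TopologicalSpace X] [CompactSpace X]
    (T : X ≃ₜ X) : ℕ∞ :=
  operatorMultiplicity (compositionOperator T)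

/-- `(X, T)` is topologically simple: its topological multiplicity is one. -/
def IsTopologicallySimple {X : Type*} [TopologicalSpace X] [CompactSpace X] (T : X ≃ₜ X) : Prop :=
  topologicalMultiplicity T = 1

/-- `(X, T)` is minimal: every orbit is dense. -/
def IsMinimalHomeomorph {X : Type*} [TopologicalSpace X] (T : X ≃ₜ X) : Prop :=
  ∀ x : X, Dense (Set.range fun k : ℤ => (T ^ k) x)

/-- The Fourier coefficient `∫ f · conj χ dλ` of `f ∈ C(G)` at a character `χ` of the compact
abelian group `G`, where `λ` is the Haar measure of total mass one. -/
noncomputable def haarFourierCoeff {G : Type*} [CommGroup G] [TopologicalSpace G]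
    [IsTopologicalGroup G] [CompactSpace G] [MeasurableSpace G] [BorelSpace G]
    (f : C(G, ℝ)) (χ : PontryaginDual G) : ℂ :=
  ∫ x, (f x : ℂ) * conj (χ x : ℂ) ∂(Measure.haarMeasure (⊤ : TopologicalSpace.PositiveCompacts G))

set_option linter.unusedSectionVars false

/-! Let `V` be the closed real span of the forward iterates of `f`. In a compact group the forward
powers of `a` are dense as soon as all integer powers are, and `x ↦ f(x ·)` is continuous in sup
norm, so `V` contains every translate of `f`. Averaging translates against `Re (c * conj χ)`
produces `Re (z χ)` for any complex `z`, because the Fourier coefficient at `χ` can be divided out.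
By Stone–Weierstrass the real and imaginary parts of characters span a dense subspace, so `V` is
everything.

Stone–Weierstrass needs characters that separate points. These come from Gelfand theory:
translations on `L²(G)` and a self-adjoint convolution operator `K` lie in a commutative C*-algebra,
and a multiplicative functional `φ` that does not kill `U g * K - K` gives the character `x ↦ φ (U
x)`, nontrivial at `g`.

A cyclic vector exists because the dual is countable: a summable series `∑ c χ • Re χ` with all `c χ
> 0` has no zero coefficient. -/

theorem exists_characterSpace_apply_ne_zero {B : Type*} [CStarAlgebra B] (A : StarSubalgebra ℂ B)
    (hA : IsClosed (A : Set B)) (hcomm : ∀ x ∈ A, ∀ y ∈ A, x * y = y * x) {t : A} (ht : t ≠ 0) :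
    ∃ φ : WeakDual.characterSpace ℂ A, φ t ≠ 0 := by
  have := hA
  let : CommCStarAlgebra A :=
    { StarSubalgebra.cstarAlgebra A with
      mul_comm := fun x y => Subtype.ext (hcomm x x.2 y y.2) }
  by_contra! h
  refine ht ((gelfandTransform_isometry A).injective ?_)
  ext φ
  simpa using h φ

/-- `U` need not be norm continuous, but `K` smooths it: `φ (U x) = φ (U x * K) / φ K`. The division
is legitimate since `φ (U g * K - K) = (φ (U g) - 1) * φ K` is nonzero, which also gives `φ (U g) ≠
1`. -/
theorem exists_pontryaginDual_apply_ne_one {B G : Type*} [CStarAlgebra B] [CommGroup G]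
    [TopologicalSpace G] [IsTopologicalGroup G] (U : G →* unitary B) (K : B)
    (hK : IsSelfAdjoint K) (hcomm : ∀ x, (U x : B) * K = K * U x)
    (hcont : Continuous fun x => (U x : B) * K) {g : G} (hg : (U g : B) * K ≠ K) :
    ∃ χ : PontryaginDual G, χ g ≠ 1 := by
  let S : Set B := insert K (Set.range fun x => (U x : B))
  have hUU (x y : G) : (U x : B) * U y = U y * U x := by
    rw [← Submonoid.coe_mul, ← Submonoid.coe_mul, ← map_mul, ← map_mul, mul_comm]
  have hUs (x : G) : star (U x : B) = U x⁻¹ := by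
    rw [map_inv]; rfl
  have hS : ∀ x ∈ S, ∀ y ∈ S, x * y = y * x := by
    rintro _ (rfl | ⟨x, rfl⟩) _ (rfl | ⟨y, rfl⟩)
    · rfl
    · exact (hcomm y).symm
    · exact hcomm x
    · exact hUU x y
  have hSs : ∀ x ∈ S, star x ∈ S := by
    rintro _ (rfl | ⟨x, rfl⟩)
    · rw [hK.star_eq]; exact Set.mem_insert _ _
    · exact Set.mem_insert_of_mem _ ⟨x⁻¹, (hUs x).symm⟩
  have hSu : S ∪ star S = S := Set.union_eq_self_of_subset_right fun x hx => by
    simpa using hSs _ hx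
  -- The bicommutant of a commuting, star-closed set is a closed commutative star subalgebra
  -- containing it.
  let A : StarSubalgebra ℂ B :=
    StarSubalgebra.centralizer ℂ (StarSubalgebra.centralizer ℂ S : Set B)
  have hAS : (A : Set B) = S.centralizer.centralizer := by
    rw [StarSubalgebra.coe_centralizer_centralizer, hSu]
  have hSA : S ⊆ A := hAS ▸ Set.subset_centralizer_centralizer
  have hAc : IsClosed (A : Set B) := by rw [hAS]; exact Set.isClosed_centralizer _
  have hAcomm : ∀ x ∈ A, ∀ y ∈ A, x * y = y * x := by
    intro x hx y hy
    rw [← SetLike.mem_coe, hAS] at hx hy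
    exact Set.centralizer_centralizer_comm_of_comm hS x hx y hy
  let k : A := ⟨K, hSA (Set.mem_insert _ _)⟩
  let u (x : G) : A := ⟨U x, hSA (Set.mem_insert_of_mem _ ⟨x, rfl⟩)⟩
  have hu_mul (x y : G) : u (x * y) = u x * u y := Subtype.ext (by simp [u])
  have hu_one : u 1 = 1 := Subtype.ext (by simp [u])
  obtain ⟨φ, hφ⟩ := exists_characterSpace_apply_ne_zero A hAc hAcomm (t := u g * k - k)
    (fun h => hg (sub_eq_zero.mp (congrArg Subtype.val h)))
  have := hAc
  have : CompleteSpace A := hAc.completeSpace_coe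
  have hφ' : (φ (u g) - 1) * φ k ≠ 0 := by
    rw [map_sub, map_mul] at hφ; rwa [sub_mul, one_mul]
  have hφk : φ k ≠ 0 := right_ne_zero_of_mul hφ'
  have hφU (x y : G) : φ (u (x * y)) = φ (u x) * φ (u y) := by rw [hu_mul, map_mul]
  have hφ1 : φ (u 1) = 1 := by rw [hu_one, map_one]
  have hle (x : G) : ‖φ (u x)‖ ≤ 1 := by
    have : Nontrivial B := ⟨⟨_, _, hg⟩⟩
    have : ‖u x‖ = 1 := CStarRing.norm_coe_unitary (U x)
    simpa [this] using spectrum.norm_le_norm_mul_of_mem (𝕜 := ℂ)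
      (AlgHom.apply_mem_spectrum φ (u x))
  have hnorm (x : G) : ‖φ (u x)‖ = 1 := by
    refine le_antisymm (hle x) ?_
    have : ‖φ (u x)‖ * ‖φ (u x⁻¹)‖ = 1 := by rw [← norm_mul, ← hφU, mul_inv_cancel, hφ1, norm_one]
    nlinarith [hle x⁻¹, norm_nonneg (φ (u x))]
  have hcφ : Continuous fun x => φ (u x) := by
    have h1 : Continuous fun x => φ (u x * k) :=
      (map_continuous φ).comp (Continuous.subtype_mk hcont _)
    have h2 : (fun x => φ (u x)) = fun x => φ (u x * k) * (φ k)⁻¹ := by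
      ext x; rw [map_mul, mul_inv_cancel_right₀ hφk]
    rw [h2]; exact h1.mul continuous_const
  let χ : G →ₜ* Circle :=
    { toFun := fun x => ⟨φ (u x), mem_sphere_zero_iff_norm.2 (hnorm x)⟩
      map_one' := Subtype.ext hφ1
      map_mul' := fun x y => Subtype.ext (hφU x y)
      continuous_toFun := Continuous.subtype_mk hcφ _ }
  refine ⟨χ, fun h => left_ne_zero_of_mul hφ' ?_⟩
  have : φ (u g) = 1 := congrArg Subtype.val h
  rw [this, sub_self]

/-! ### Convolution operators of a strongly continuous unitary representation -/

section UnitaryRepresentation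

variable {G H : Type*} [CommGroup G] [TopologicalSpace G] [IsTopologicalGroup G] [CompactSpace G]
  [MeasurableSpace G] [BorelSpace G] [NormedAddCommGroup H] [InnerProductSpace ℂ H]
  [CompleteSpace H]

theorem ContinuousMap.integrable_of_compactSpace {X E : Type*} [TopologicalSpace X] [CompactSpace X]
    [MeasurableSpace X] [BorelSpace X] [NormedAddCommGroup E] (μ : Measure X) [IsFiniteMeasure μ]
    {f : X → E} (hf : Continuous f) : Integrable f μ :=
  hf.integrable_of_hasCompactSupport (HasCompactSupport.of_compactSpace f)

/-- The operator `∫ h(x) U(x) dμ` attached to a strongly continuous unitary representation. -/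
noncomputable def unitaryConvolution (μ : Measure G) [IsFiniteMeasure μ]
    (U : G →* unitary (H →L[ℂ] H))
    (hU : ∀ v, Continuous fun x => (U x : H →L[ℂ] H) v) : C(G, ℂ) →L[ℂ] H →L[ℂ] H :=
  LinearMap.mkContinuous₂
    (LinearMap.mk₂ ℂ (fun (h : C(G, ℂ)) v => ∫ x, h x • (U x : H →L[ℂ] H) v ∂μ)
      (fun h h' v => by
        simp only [ContinuousMap.add_apply, add_smul]
        exact integral_add
          (ContinuousMap.integrable_of_compactSpace μ (h.continuous.smul (hU v)))
          (ContinuousMap.integrable_of_compactSpace μ (h'.continuous.smul (hU v))))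
      (fun c h v => by
        simp only [ContinuousMap.smul_apply, smul_assoc]
        exact integral_smul c _)
      (fun h v w => by
        simp only [map_add, smul_add]
        exact integral_add
          (ContinuousMap.integrable_of_compactSpace μ (h.continuous.smul (hU v)))
          (ContinuousMap.integrable_of_compactSpace μ (h.continuous.smul (hU w))))
      (fun c h v => by
        simp only [map_smul, smul_comm _ c]
        exact integral_smul c _))
    (μ.real Set.univ)
    (fun h v => by
      rw [mul_assoc, mul_comm]
      refine norm_integral_le_of_norm_le_const (Filter.Eventually.of_forall fun x => ?_)
      have hx : ‖(U x : H →L[ℂ] H) v‖ ≤ ‖v‖ := by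
        rcases subsingleton_or_nontrivial H with hs | hs
        · rw [Subsingleton.elim v 0, map_zero]
        · simpa [CStarRing.norm_coe_unitary] using (U x : H →L[ℂ] H).le_opNorm v
      rw [norm_smul]
      gcongr
      exact h.norm_coe_le_norm x)

variable (μ : Measure G) [IsFiniteMeasure μ] (U : G →* unitary (H →L[ℂ] H))
  (hU : ∀ v, Continuous fun x => (U x : H →L[ℂ] H) v)

theorem unitaryConvolution_apply (h : C(G, ℂ)) (v : H) :
    unitaryConvolution μ U hU h v = ∫ x, h x • (U x : H →L[ℂ] H) v ∂μ := rfl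

theorem integrable_smul_unitary (hU : ∀ v, Continuous fun x => (U x : H →L[ℂ] H) v) (h : C(G, ℂ)) (v : H) :
    Integrable (fun x => h x • (U x : H →L[ℂ] H) v) μ :=
  ContinuousMap.integrable_of_compactSpace μ (h.continuous.smul (hU v))

theorem inner_unitaryConvolution (h : C(G, ℂ)) (v w : H) :
    inner ℂ w (unitaryConvolution μ U hU h v) = ∫ x, h x * inner ℂ w ((U x : H →L[ℂ] H) v) ∂μ := by
  rw [unitaryConvolution_apply, ← integral_inner (integrable_smul_unitary μ U hU h v)]
  simp only [inner_smul_right]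

theorem unitary_mul_apply (x y : G) (v : H) :
    (U (x * y) : H →L[ℂ] H) v = (U x : H →L[ℂ] H) ((U y : H →L[ℂ] H) v) := by
  rw [map_mul]; rfl

theorem unitary_comm_unitaryConvolution (h : C(G, ℂ)) (y : G) :
    (U y : H →L[ℂ] H) * unitaryConvolution μ U hU h =
      unitaryConvolution μ U hU h * (U y : H →L[ℂ] H) := by
  ext v
  simp only [mul_apply_eq_comp, unitaryConvolution_apply]
  rw [← ContinuousLinearMap.integral_comp_comm _ (integrable_smul_unitary μ U hU h v)]
  simp only [map_smul, ← unitary_mul_apply, mul_comm y]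

/-- Invariance of `μ` moves the translation onto `h`, so norm continuity of `y ↦ U y * K` reduces to
sup-norm continuity of translating `h`. -/
theorem unitary_mul_unitaryConvolution [μ.IsMulLeftInvariant] (h : C(G, ℂ)) (y : G) :
    (U y : H →L[ℂ] H) * unitaryConvolution μ U hU h =
      unitaryConvolution μ U hU (h.comp (Homeomorph.mulLeft y⁻¹ : C(G, G))) := by
  ext v
  simp only [mul_apply_eq_comp, unitaryConvolution_apply]
  rw [← ContinuousLinearMap.integral_comp_comm _ (integrable_smul_unitary μ U hU h v),
    ← integral_mul_left_eq_self (μ := μ)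
      (fun x => (h.comp (Homeomorph.mulLeft y⁻¹ : C(G, G))) x • (U x : H →L[ℂ] H) v) y]
  simp

theorem continuous_comp_mulLeft_inv (h : C(G, ℂ)) :
    Continuous fun y : G => h.comp (Homeomorph.mulLeft y⁻¹ : C(G, G)) :=
  (ContinuousMap.curry ⟨fun p : G × G => h (p.1⁻¹ * p.2), by fun_prop⟩).continuous

theorem isSelfAdjoint_unitaryConvolution [μ.IsInvInvariant] (h : C(G, ℂ))
    (hh : ∀ x, h x⁻¹ = conj (h x)) : IsSelfAdjoint (unitaryConvolution μ U hU h) := by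
  rw [ContinuousLinearMap.isSelfAdjoint_iff_isSymmetric]
  intro v w
  change inner ℂ (unitaryConvolution μ U hU h v) w = inner ℂ v (unitaryConvolution μ U hU h w)
  rw [← inner_conj_symm, inner_unitaryConvolution, inner_unitaryConvolution, ← integral_conj,
    ← integral_inv_eq_self]
  refine integral_congr_ae (Filter.Eventually.of_forall fun x => ?_)
  have hx : (((U x)⁻¹ : unitary (H →L[ℂ] H)) : H →L[ℂ] H) =
      ContinuousLinearMap.adjoint (U x : H →L[ℂ] H) := rfl
  simp [hh, hx, ContinuousLinearMap.adjoint_inner_left]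

theorem exists_pontryaginDual_apply_ne_one_of_integral_ne [μ.IsMulLeftInvariant]
    [μ.IsInvInvariant] (hU : ∀ v, Continuous fun x => (U x : H →L[ℂ] H) v) {g : G} (h : C(G, ℂ)) (hh : ∀ x, h x⁻¹ = conj (h x)) (v w : H)
    (hne : ∫ x, h x * inner ℂ w ((U (g * x) : H →L[ℂ] H) v) ∂μ ≠
      ∫ x, h x * inner ℂ w ((U x : H →L[ℂ] H) v) ∂μ) :
    ∃ χ : PontryaginDual G, χ g ≠ 1 := by
  refine _root_.exists_pontryaginDual_apply_ne_one U (unitaryConvolution μ U hU h)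
    (isSelfAdjoint_unitaryConvolution μ U hU h hh)
    (unitary_comm_unitaryConvolution μ U hU h) ?_ (g := g) fun heq => hne ?_
  · simp only [unitary_mul_unitaryConvolution]
    exact (unitaryConvolution μ U hU).continuous.comp (continuous_comp_mulLeft_inv h)
  · have := congrArg (fun T : H →L[ℂ] H => inner ℂ w (T v)) heq
    simp only [inner_unitaryConvolution] at this
    rw [← this, mul_apply_eq_comp, unitaryConvolution_apply,
      ← ContinuousLinearMap.integral_comp_comm _ (integrable_smul_unitary μ U hU h v),
      ← integral_inner (ContinuousLinearMap.integrable_comp _ (integrable_smul_unitary μ U hU h v))]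
    simp [inner_smul_right]

end UnitaryRepresentation

/-! ### The regular representation and separation of points -/

section RegularRepresentation

variable {G : Type*} [CommGroup G] [TopologicalSpace G] [IsTopologicalGroup G] [CompactSpace G]
  [T2Space G] [SecondCountableTopology G] [MeasurableSpace G] [BorelSpace G]

/-- Translation of square integrable functions as a unitary representation. -/
noncomputable def regularUnitary (μ : Measure G) [μ.IsMulLeftInvariant] :
    G →* unitary (Lp ℂ 2 μ →L[ℂ] Lp ℂ 2 μ) :=
  (Unitary.linearIsometryEquiv (𝕜 := ℂ) (H := Lp ℂ 2 μ)).symm.toMonoidHom.comp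
    { toFun := fun x =>
        { toFun := fun v => DomMulAct.mk x • v
          invFun := fun v => DomMulAct.mk x⁻¹ • v
          left_inv := fun v => by
            dsimp only
            rw [← mul_smul, ← DomMulAct.mk_mul]; simp
          right_inv := fun v => by
            dsimp only
            rw [← mul_smul, ← DomMulAct.mk_mul]; simp
          map_add' := fun v w => DomMulAct.smul_Lp_add _ v w
          map_smul' := fun c v => smul_comm _ c v
          norm_map' := fun v => DomMulAct.norm_smul_Lp _ v }
      map_one' := by ext1 v; exact one_smul Gᵈᵐᵃ v
      -- `DomMulAct` reverses products; commutativity of `G` restores the order.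
      map_mul' := fun x y => by
        ext1 v
        change DomMulAct.mk (x * y) • v = DomMulAct.mk x • DomMulAct.mk y • v
        rw [← mul_smul, ← DomMulAct.mk_mul, mul_comm] }

theorem regularUnitary_apply (μ : Measure G) [μ.IsMulLeftInvariant] (x : G) (v : Lp ℂ 2 μ) :
    (regularUnitary μ x : Lp ℂ 2 μ →L[ℂ] Lp ℂ 2 μ) v = DomMulAct.mk x • v := rfl

theorem continuous_regularUnitary_apply (μ : Measure G) [μ.IsHaarMeasure] (v : Lp ℂ 2 μ) :
    Continuous fun x => (regularUnitary μ x : Lp ℂ 2 μ →L[ℂ] Lp ℂ 2 μ) v := by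
  have : Fact ((2 : ENNReal) ≠ ⊤) := ⟨by simp⟩
  simp only [regularUnitary_apply]
  exact DomMulAct.continuous_mk.smul continuous_const

theorem regularUnitary_toLp (μ : Measure G) [μ.IsHaarMeasure] (x : G) (b : C(G, ℂ)) :
    (regularUnitary μ x : Lp ℂ 2 μ →L[ℂ] Lp ℂ 2 μ) (ContinuousMap.toLp 2 μ ℂ b) =
      ContinuousMap.toLp 2 μ ℂ (b.comp (Homeomorph.mulLeft x : C(G, G))) := rfl

theorem inner_regularUnitary_toLp (μ : Measure G) [μ.IsHaarMeasure] (x : G) (b c : C(G, ℂ)) :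
    inner ℂ (ContinuousMap.toLp 2 μ ℂ c)
      ((regularUnitary μ x : Lp ℂ 2 μ →L[ℂ] Lp ℂ 2 μ) (ContinuousMap.toLp 2 μ ℂ b)) =
      ∫ y, b (x * y) * conj (c y) ∂μ := by
  rw [regularUnitary_toLp, ContinuousMap.inner_toLp]; rfl

/-- If the product were nonzero, `g * x * y`, `x⁻¹` and `y⁻¹` would all lie in `V`, and their
product is `g`, which `V * V * V * V` avoids. -/
theorem exists_symmetric_bump {g : G} (hg : g ≠ 1) :
    ∃ b : C(G, ℝ), b 1 = 1 ∧ (∀ x, 0 ≤ b x) ∧ (∀ x, b x⁻¹ = b x) ∧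
      ∀ x y, b x * (b (g * x * y) * b y) = 0 := by
  obtain ⟨V, hV, hVg⟩ := exists_nhds_one_split4 (isOpen_compl_singleton.mem_nhds hg.symm)
  obtain ⟨u, hu0, hu1, hu⟩ := exists_continuous_zero_one_of_isClosed
    (isOpen_interior (s := V)).isClosed_compl (isClosed_singleton (x := (1 : G)))
    (Set.disjoint_singleton_right.2 (by simpa [mem_interior_iff_mem_nhds] using hV))
  have hmem : ∀ x, u x ≠ 0 → x ∈ V := fun x hx =>
    interior_subset (by_contra fun h => hx (hu0 h))
  refine ⟨⟨fun x => u x * u x⁻¹, by fun_prop⟩, by simp [hu1 (Set.mem_singleton _)],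
    fun x => mul_nonneg (hu x).1 (hu x⁻¹).1, fun x => by simp [mul_comm], fun x y => ?_⟩
  by_contra h
  simp only [ContinuousMap.coe_mk, mul_eq_zero, not_or] at h
  obtain ⟨⟨-, hx⟩, ⟨hgxy, -⟩, -, hy⟩ := h
  refine hVg (hmem _ hgxy) (hmem _ hx) (hmem _ hy) (mem_of_mem_nhds hV) ?_
  simp [mul_assoc, mul_comm x]

/-- The continuous characters of a compact metrizable abelian group separate points. -/
theorem PontryaginDual.exists_apply_ne_one {g : G} (hg : g ≠ 1) :
    ∃ χ : PontryaginDual G, χ g ≠ 1 := by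
  obtain ⟨b, hb1, hb0, hbs, hbg⟩ := exists_symmetric_bump hg
  let μ : Measure G := Measure.haarMeasure ⊤
  let B : C(G, ℂ) := ⟨fun x => (b x : ℂ), by fun_prop⟩
  have hB (x : G) : B x = (b x : ℂ) := rfl
  refine exists_pontryaginDual_apply_ne_one_of_integral_ne μ (regularUnitary μ)
    (continuous_regularUnitary_apply μ) B (fun x => by simp [hB, hbs])
    (ContinuousMap.toLp 2 μ ℂ B) (ContinuousMap.toLp 2 μ ℂ B) ?_
  -- The autocorrelation of `b`, a matrix coefficient of translation. Against `b` it integrates to a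
  -- positive number, while its translate by `g` integrates to zero.
  let c : G → ℝ := fun x => ∫ y, b (x * y) * b y ∂μ
  have hc (x : G) : inner ℂ (ContinuousMap.toLp 2 μ ℂ B)
      ((regularUnitary μ x : Lp ℂ 2 μ →L[ℂ] Lp ℂ 2 μ) (ContinuousMap.toLp 2 μ ℂ B)) =
      (c x : ℂ) := by
    rw [inner_regularUnitary_toLp]
    simp only [hB, Complex.conj_ofReal, ← Complex.ofReal_mul, integral_complex_ofReal, c]
  have hc_cont : Continuous c := by
    have h := (continuous_const (y := ContinuousMap.toLp 2 μ ℂ B)).inner (𝕜 := ℂ)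
      (continuous_regularUnitary_apply μ (ContinuousMap.toLp 2 μ ℂ B))
    simp only [hc] at h
    exact Complex.continuous_re.comp h
  have hpos {k : G → ℝ} (hk : Continuous k) (hk0 : 0 ≤ k) (hk1 : k 1 ≠ 0) :
      0 < ∫ x, k x ∂μ :=
    hk.integral_pos_of_hasCompactSupport_nonneg_nonzero (HasCompactSupport.of_compactSpace k)
      hk0 hk1
  have hc1 : 0 < c 1 := hpos (k := fun y => b (1 * y) * b y) (by fun_prop)
    (fun y => mul_nonneg (hb0 _) (hb0 _)) (by simp [hb1])
  have h1 : 0 < ∫ x, b x * c x ∂μ := hpos (by fun_prop)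
    (fun x => mul_nonneg (hb0 x) (integral_nonneg fun y => mul_nonneg (hb0 _) (hb0 _)))
    (by simpa [hb1] using hc1.ne')
  have h2 : ∫ x, b x * c (g * x) ∂μ = 0 := by
    simp only [c, ← integral_const_mul, hbg, integral_zero]
  simp only [hc, hB, ← Complex.ofReal_mul, integral_complex_ofReal, h2]
  exact fun h => h1.ne (Complex.ofReal_injective h)

end RegularRepresentation

/-! ### Density of characters and Fourier coefficients -/

section Characters

variable {G : Type*} [CommGroup G] [TopologicalSpace G] [IsTopologicalGroup G] [CompactSpace G]

/-- A character as a continuous complex function. -/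
noncomputable def PontryaginDual.toComplex : PontryaginDual G →* C(G, ℂ) where
  toFun χ := ⟨fun x => (χ x : ℂ), by fun_prop⟩
  map_one' := rfl
  map_mul' _ _ := rfl

/-- The real part of a continuous complex function. -/
noncomputable def ContinuousMap.reMap : C(G, ℂ) →L[ℝ] C(G, ℝ) :=
  Complex.reCLM.compLeftContinuous ℝ G

/-- The imaginary part of a continuous complex function. -/
noncomputable def ContinuousMap.imMap : C(G, ℂ) →L[ℝ] C(G, ℝ) :=
  Complex.imCLM.compLeftContinuous ℝ G

theorem PontryaginDual.coe_inv_apply (χ : PontryaginDual G) (x : G) :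
    ((χ⁻¹ x : Circle) : ℂ) = conj (χ x : ℂ) := by
  rw [← Circle.coe_inv_eq_conj]; rfl

theorem PontryaginDual.coe_mul_apply (χ ψ : PontryaginDual G) (x : G) :
    (((χ * ψ) x : Circle) : ℂ) = (χ x : ℂ) * (ψ x : ℂ) := rfl

/-- Characters form a monoid closed under conjugation, so their linear span is already a star
subalgebra and Stone–Weierstrass applies. -/
theorem PontryaginDual.span_toComplex_topologicalClosure [T2Space G]
    [SecondCountableTopology G] [MeasurableSpace G] [BorelSpace G] :
    (Submodule.span ℂ (Set.range (PontryaginDual.toComplex (G := G)))).topologicalClosure = ⊤ := by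
  let A : StarSubalgebra ℂ C(G, ℂ) :=
    { Algebra.adjoin ℂ (Set.range (PontryaginDual.toComplex (G := G))) with
      star_mem' := by
        change Algebra.adjoin ℂ (Set.range (PontryaginDual.toComplex (G := G))) ≤
          star (Algebra.adjoin ℂ (Set.range (PontryaginDual.toComplex (G := G))))
        refine Algebra.adjoin_le ?_
        rintro _ ⟨χ, rfl⟩
        refine Algebra.subset_adjoin ⟨χ⁻¹, ?_⟩
        ext x
        exact PontryaginDual.coe_inv_apply χ x }
  have hA : (A : Set C(G, ℂ)) =
      Submodule.span ℂ (Set.range (PontryaginDual.toComplex (G := G))) := by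
    have h : Subalgebra.toSubmodule (Algebra.adjoin ℂ (Set.range (toComplex (G := G)))) =
        Submodule.span ℂ (Set.range (toComplex (G := G))) := by
      rw [Algebra.adjoin_eq_span, ← MonoidHom.coe_mrange, Submonoid.closure_eq]
    exact congrArg (fun W : Submodule ℂ C(G, ℂ) => (W : Set C(G, ℂ))) h
  have hsep : A.SeparatesPoints := by
    intro x y hxy
    obtain ⟨χ, hχ⟩ := PontryaginDual.exists_apply_ne_one (g := x * y⁻¹)
      (fun h => hxy (mul_inv_eq_one.1 h))
    refine ⟨_, ⟨PontryaginDual.toComplex χ, Algebra.subset_adjoin ⟨χ, rfl⟩, rfl⟩, fun h => hχ ?_⟩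
    rw [_root_.map_mul, map_inv, mul_inv_eq_one]
    exact Circle.ext h
  have htop := ContinuousMap.starSubalgebra_topologicalClosure_eq_top_of_separatesPoints A hsep
  refine SetLike.coe_injective ?_
  rw [Submodule.topologicalClosure_coe, ← hA, ← StarSubalgebra.topologicalClosure_coe, htop]
  rfl

/-- A closed real subspace of `C(G)` containing the real and imaginary parts of all characters
is everything. -/
theorem Submodule.eq_top_of_forall_pontryaginDual_mem [T2Space G] [SecondCountableTopology G]
    [MeasurableSpace G] [BorelSpace G] (V : Submodule ℝ C(G, ℝ)) (hV : IsClosed (V : Set C(G, ℝ)))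
    (hχ : ∀ χ : PontryaginDual G, ContinuousMap.reMap (PontryaginDual.toComplex χ) ∈ V ∧
      ContinuousMap.imMap (PontryaginDual.toComplex χ) ∈ V) : V = ⊤ := by
  have hspan : ∀ p ∈ Submodule.span ℂ (Set.range (PontryaginDual.toComplex (G := G))),
      ContinuousMap.reMap p ∈ V ∧ ContinuousMap.imMap p ∈ V := by
    intro p hp
    induction hp using Submodule.span_induction with
    | mem p hp => obtain ⟨χ, rfl⟩ := hp; exact hχ χ
    | zero => simp
    | add p q _ _ hp hq => simpa using ⟨V.add_mem hp.1 hq.1, V.add_mem hp.2 hq.2⟩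
    | smul c p _ hp =>
      have hre : ContinuousMap.reMap (c • p) =
          c.re • ContinuousMap.reMap p - c.im • ContinuousMap.imMap p := by
        ext x; simp [ContinuousMap.reMap, ContinuousMap.imMap]
      have him : ContinuousMap.imMap (c • p) =
          c.re • ContinuousMap.imMap p + c.im • ContinuousMap.reMap p := by
        ext x; simp [ContinuousMap.reMap, ContinuousMap.imMap]
      rw [hre, him]
      exact ⟨V.sub_mem (V.smul_mem _ hp.1) (V.smul_mem _ hp.2),
        V.add_mem (V.smul_mem _ hp.2) (V.smul_mem _ hp.1)⟩
  rw [eq_top_iff]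
  intro f _
  have hf : (⟨fun x => (f x : ℂ), by fun_prop⟩ : C(G, ℂ)) ∈
      (Submodule.span ℂ (Set.range (PontryaginDual.toComplex (G := G)))).topologicalClosure := by
    rw [PontryaginDual.span_toComplex_topologicalClosure]; trivial
  have := map_mem_closure (ContinuousMap.reMap (G := G)).continuous hf
    (t := (V : Set C(G, ℝ))) fun p hp => (hspan p hp).1
  rw [hV.closure_eq] at this
  exact this

/-- The dual of a compact group is discrete, and it inherits second countability from the space of
continuous maps to the circle. -/
instance PontryaginDual.countable [SecondCountableTopology G] :
    Countable (PontryaginDual G) := by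
  have : SecondCountableTopology (PontryaginDual G) :=
    (ContinuousMonoidHom.isInducing_toContinuousMap G Circle).secondCountableTopology
  exact TopologicalSpace.separableSpace_iff_countable.1 inferInstance

variable [MeasurableSpace G] [BorelSpace G]

theorem PontryaginDual.integral_eq_zero (μ : Measure G) [μ.IsMulLeftInvariant]
    {χ : PontryaginDual G} (hχ : χ ≠ 1) : ∫ x, (χ x : ℂ) ∂μ = 0 := by
  obtain ⟨g, hg⟩ : ∃ g, χ g ≠ 1 := by
    by_contra! h
    exact hχ (PontryaginDual.ext h)
  have h := integral_mul_left_eq_self (μ := μ) (fun x => (χ x : ℂ)) g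
  simp only [_root_.map_mul, Circle.coe_mul, integral_const_mul] at h
  have h' : ((χ g : ℂ) - 1) * ∫ x, (χ x : ℂ) ∂μ = 0 := by rw [sub_mul, h, one_mul, sub_self]
  refine (mul_eq_zero.1 h').resolve_left fun h0 => hg (Circle.ext ?_)
  simpa using sub_eq_zero.1 h0

instance haarMeasure_top_isProbabilityMeasure :
    IsProbabilityMeasure (Measure.haarMeasure (⊤ : TopologicalSpace.PositiveCompacts G)) :=
  ⟨Measure.haarMeasure_self⟩

-- Orthogonality applied to `Re χ = (χ + χ⁻¹) / 2`; both terms count when `χ = χ⁻¹`. The values are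
-- nonnegative, so no cancellation can occur in a positive combination.
open Classical in
theorem haarFourierCoeff_re_toComplex (χ ψ : PontryaginDual G) :
    haarFourierCoeff (ContinuousMap.reMap (PontryaginDual.toComplex χ)) ψ =
      (((if χ = ψ then 1 else 0) + (if χ⁻¹ = ψ then 1 else 0)) / 2 : ℝ) := by
  let μ := Measure.haarMeasure (⊤ : TopologicalSpace.PositiveCompacts G)
  have horth (ω : PontryaginDual G) : ∫ x, ((ω * ψ⁻¹) x : ℂ) ∂μ = if ω = ψ then 1 else 0 := by
    split_ifs with h
    · subst h
      rw [mul_inv_cancel]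
      simp
    · exact PontryaginDual.integral_eq_zero μ fun h' => h (mul_inv_eq_one.1 h')
  have hint (ω : PontryaginDual G) : Integrable (fun x => (ω x : ℂ)) μ :=
    ContinuousMap.integrable_of_compactSpace μ (by fun_prop)
  have hpt (x : G) : ((ContinuousMap.reMap (PontryaginDual.toComplex χ) x : ℝ) : ℂ) *
      conj (ψ x : ℂ) = (((χ * ψ⁻¹) x : ℂ) + ((χ⁻¹ * ψ⁻¹) x : ℂ)) / 2 := by
    simp only [PontryaginDual.coe_mul_apply, PontryaginDual.coe_inv_apply]
    have : ((ContinuousMap.reMap (PontryaginDual.toComplex χ) x : ℝ) : ℂ) =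
      ((χ x : ℂ) + conj (χ x : ℂ)) / 2 := Complex.re_eq_add_conj (χ x : ℂ)
    rw [this]; ring
  rw [haarFourierCoeff]
  simp only [hpt]
  rw [integral_div, integral_add (hint _) (hint _)]
  change ((∫ x, ((χ * ψ⁻¹) x : ℂ) ∂μ) + ∫ x, ((χ⁻¹ * ψ⁻¹) x : ℂ) ∂μ) / 2 = _
  rw [horth, horth]
  push_cast
  split_ifs <;> simp

/-- The Fourier coefficient at `χ` as a continuous linear functional. -/
noncomputable def haarFourierCoeffCLM (χ : PontryaginDual G) : C(G, ℝ) →L[ℝ] ℂ :=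
  LinearMap.mkContinuous
    { toFun := fun f => haarFourierCoeff f χ
      map_add' := fun f g => by
        simp only [haarFourierCoeff, ContinuousMap.add_apply, Complex.ofReal_add, add_mul]
        exact integral_add (ContinuousMap.integrable_of_compactSpace _ (by fun_prop))
          (ContinuousMap.integrable_of_compactSpace _ (by fun_prop))
      map_smul' := fun c f => by
        simp only [haarFourierCoeff, ContinuousMap.smul_apply, smul_eq_mul, Complex.ofReal_mul,
          mul_assoc, integral_const_mul, RingHom.id_apply, Complex.real_smul] } 1
    fun f => by
      refine (norm_integral_le_of_norm_le_const (C := ‖f‖)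
        (Filter.Eventually.of_forall fun x => ?_)).trans (by simp)
      rw [norm_mul, RCLike.norm_conj, Circle.norm_coe, mul_one, Complex.norm_real]
      exact f.norm_coe_le_norm x

open Classical in
theorem exists_forall_haarFourierCoeff_ne_zero [SecondCountableTopology G] :
    ∃ f : C(G, ℝ), ∀ χ : PontryaginDual G, haarFourierCoeff f χ ≠ 0 := by
  have := Encodable.ofCountable (PontryaginDual G)
  obtain ⟨c, hc0, s, hc, -⟩ := posSumOfEncodable one_pos (PontryaginDual G)
  have hsum : Summable fun χ : PontryaginDual G =>
      c χ • ContinuousMap.reMap (PontryaginDual.toComplex χ) := by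
    refine Summable.of_norm_bounded hc.summable fun χ => ?_
    rw [norm_smul, Real.norm_of_nonneg (hc0 χ).le]
    refine mul_le_of_le_one_right (hc0 χ).le
      ((ContinuousMap.norm_le _ zero_le_one).2 fun x => ?_)
    exact (Complex.abs_re_le_norm _).trans (Circle.norm_coe (χ x)).le
  refine ⟨∑' χ, c χ • ContinuousMap.reMap (PontryaginDual.toComplex χ), fun ψ h => ?_⟩
  let t (χ : PontryaginDual G) : ℝ :=
    c χ * (((if χ = ψ then 1 else 0) + (if χ⁻¹ = ψ then 1 else 0)) / 2)
  have hcoeff := Complex.hasSum_re (hsum.hasSum.mapL (haarFourierCoeffCLM ψ))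
  have hre (χ : PontryaginDual G) : ((haarFourierCoeffCLM ψ)
      (c χ • ContinuousMap.reMap (PontryaginDual.toComplex χ))).re = t χ := by
    rw [map_smul]
    change (c χ • haarFourierCoeff (ContinuousMap.reMap (PontryaginDual.toComplex χ)) ψ).re = _
    rw [haarFourierCoeff_re_toComplex, Complex.smul_re, Complex.ofReal_re, smul_eq_mul]
  simp only [hre] at hcoeff
  have ht0 (χ : PontryaginDual G) : 0 ≤ t χ :=
    mul_nonneg (hc0 χ).le (by split_ifs <;> norm_num)
  have htψ : 0 < t ψ := mul_pos (hc0 ψ) (by simp only [if_true]; split_ifs <;> norm_num)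
  have hpos := hcoeff.summable.tsum_pos ht0 ψ htψ
  rw [hcoeff.tsum_eq] at hpos
  exact hpos.ne' (congrArg Complex.re h)

end Characters

/-! ### Minimal translations and cyclic vectors -/

section Translation

variable {G : Type*} [CommGroup G] [TopologicalSpace G] [IsTopologicalGroup G]

theorem Homeomorph.mulLeft_zpow_apply_one (a : G) (k : ℤ) :
    ((Homeomorph.mulLeft a) ^ k) 1 = a ^ k := by
  let Φ : G →* (G ≃ₜ G) :=
    { toFun := Homeomorph.mulLeft
      map_one' := by ext x; exact one_mul x
      map_mul' := fun x y => by ext z; exact mul_assoc x y z }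
  have h : Homeomorph.mulLeft a ^ k = Homeomorph.mulLeft (a ^ k) := (map_zpow Φ a k).symm
  rw [h]
  exact mul_one _

theorem IsMinimalHomeomorph.denseRange_pow [CompactSpace G] {a : G}
    (h : IsMinimalHomeomorph (Homeomorph.mulLeft a)) : DenseRange fun k : ℕ => a ^ k := by
  rw [← denseRange_zpow_iff_pow]
  have h1 := h 1
  simp only [Homeomorph.mulLeft_zpow_apply_one] at h1
  exact h1

variable [CompactSpace G]

theorem compositionOperator_mulLeft_pow (a : G) (k : ℕ) (f : C(G, ℝ)) :
    (compositionOperator (Homeomorph.mulLeft a) ^ k) f =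
      f.comp (Homeomorph.mulLeft (a ^ k) : C(G, G)) := by
  induction k with
  | zero =>
    ext x
    change f x = f (a ^ 0 * x)
    rw [pow_zero, one_mul]
  | succ k ih =>
    rw [pow_succ']
    change compositionOperator (Homeomorph.mulLeft a)
      ((compositionOperator (Homeomorph.mulLeft a) ^ k) f) = _
    rw [ih]
    ext x
    change f (a ^ k * (a * x)) = f (a ^ (k + 1) * x)
    rw [pow_succ, mul_assoc]

theorem continuous_comp_mulLeft (f : C(G, ℝ)) :
    Continuous fun y : G => f.comp (Homeomorph.mulLeft y : C(G, G)) :=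
  (ContinuousMap.curry ⟨fun p : G × G => f (p.1 * p.2), by fun_prop⟩).continuous

variable [MeasurableSpace G] [BorelSpace G]

/-- A closed translation invariant subspace containing `f` contains the real parts of all
multiples of a character at which the Fourier coefficient of `f` does not vanish. -/
theorem re_smul_toComplex_mem_of_haarFourierCoeff_ne_zero [SecondCountableTopology G]
    (V : Submodule ℝ C(G, ℝ)) (hV : IsClosed (V : Set C(G, ℝ))) (f : C(G, ℝ))
    (hf : ∀ x : G, f.comp (Homeomorph.mulLeft x : C(G, G)) ∈ V) (χ : PontryaginDual G)
    (hχ : haarFourierCoeff f χ ≠ 0) (z : ℂ) :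
    ContinuousMap.reMap (z • PontryaginDual.toComplex χ) ∈ V := by
  let μ := Measure.haarMeasure (⊤ : TopologicalSpace.PositiveCompacts G)
  -- Replacing `x` by `x * y⁻¹` turns the average of `F` at `y` into `Re (c * χ y * haarFourierCoeff
  -- f χ)`; this `c` makes it `Re (z * χ y)`.
  let c := z / haarFourierCoeff f χ
  let F : G → C(G, ℝ) := fun x =>
    (c * conj (χ x : ℂ)).re • f.comp (Homeomorph.mulLeft x : C(G, G))
  have hFc : Continuous F := by
    have hc : Continuous fun x : G => (c * conj (χ x : ℂ)).re := by fun_prop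
    exact hc.smul (continuous_comp_mulLeft f)
  have hFi : Integrable F μ := ContinuousMap.integrable_of_compactSpace μ hFc
  -- A closed convex set contains the mean of a function with values in it under a probability
  -- measure.
  have hmem : ∫ x, F x ∂μ ∈ V := V.convex.integral_mem hV
    (Filter.Eventually.of_forall fun x => V.smul_mem _ (hf x)) hFi
  convert hmem
  ext y
  have hint : Integrable (fun x => (f x : ℂ) * conj (χ x : ℂ)) μ :=
    ContinuousMap.integrable_of_compactSpace μ (by fun_prop)
  rw [ContinuousMap.integral_apply hFi,
    ← integral_mul_right_eq_self (μ := μ) (fun x => F x y) y⁻¹]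
  have hpt (x : G) : F (x * y⁻¹) y =
      (c * (χ y : ℂ) * ((f x : ℂ) * conj (χ x : ℂ))).re := by
    change (c * conj (χ (x * y⁻¹) : ℂ)).re * f (x * y⁻¹ * y) = _
    rw [inv_mul_cancel_right, map_mul, map_inv, Circle.coe_mul, Circle.coe_inv_eq_conj, map_mul,
      Complex.conj_conj, ← Complex.re_mul_ofReal]
    congr 1
    ring
  simp only [hpt]
  have hre := integral_re (𝕜 := ℂ) (hint.const_mul (c * (χ y : ℂ)))
  refine Eq.trans ?_ hre.symm
  rw [integral_const_mul]
  change (z * (χ y : ℂ)).re = (c * (χ y : ℂ) * haarFourierCoeff f χ).re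
  congr 1
  simp only [c]
  field_simp

variable [T2Space G] [SecondCountableTopology G]

theorem dense_span_range_compositionOperator_pow {a : G}
    (hmin : IsMinimalHomeomorph (Homeomorph.mulLeft a)) {f : C(G, ℝ)}
    (hf : ∀ χ : PontryaginDual G, haarFourierCoeff f χ ≠ 0) :
    Dense (Submodule.span ℝ
      (Set.range fun k : ℕ => (compositionOperator (Homeomorph.mulLeft a) ^ k) f) :
        Set C(G, ℝ)) := by
  rw [Submodule.dense_iff_topologicalClosure_eq_top]
  let V := (Submodule.span ℝ (Set.range fun k : ℕ =>
    (compositionOperator (Homeomorph.mulLeft a) ^ k) f)).topologicalClosure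
  have hV : IsClosed (V : Set C(G, ℝ)) := Submodule.isClosed_topologicalClosure _
  have htr (x : G) : f.comp (Homeomorph.mulLeft x : C(G, G)) ∈ V := by
    -- The translations keeping `f` in `V` form a closed set containing the dense forward powers of
    -- `a`.
    have hcl : IsClosed {x : G | f.comp (Homeomorph.mulLeft x : C(G, G)) ∈ V} :=
      hV.preimage (continuous_comp_mulLeft f)
    refine hmin.denseRange_pow.induction_on (p := fun x =>
      f.comp (Homeomorph.mulLeft x : C(G, G)) ∈ V) x hcl fun k => ?_
    rw [← compositionOperator_mulLeft_pow]
    exact Submodule.le_topologicalClosure _ (Submodule.subset_span ⟨k, rfl⟩)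
  refine Submodule.eq_top_of_forall_pontryaginDual_mem V hV fun χ => ⟨?_, ?_⟩
  · simpa using re_smul_toComplex_mem_of_haarFourierCoeff_ne_zero V hV f htr χ (hf χ) 1
  · have him : ContinuousMap.imMap (PontryaginDual.toComplex χ) =
        ContinuousMap.reMap (-Complex.I • PontryaginDual.toComplex χ) := by
      ext x
      simp [ContinuousMap.reMap, ContinuousMap.imMap]
    rw [him]
    exact re_smul_toComplex_mem_of_haarFourierCoeff_ne_zero V hV f htr χ (hf χ) (-Complex.I)

theorem isGeneratingFamily_singleton_compositionOperator {a : G}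
    (hmin : IsMinimalHomeomorph (Homeomorph.mulLeft a)) {f : C(G, ℝ)}
    (hf : ∀ χ : PontryaginDual G, haarFourierCoeff f χ ≠ 0) :
    IsGeneratingFamily (compositionOperator (Homeomorph.mulLeft a)) {f} := by
  have h := Submodule.dense_iff_topologicalClosure_eq_top.1
    (dense_span_range_compositionOperator_pow hmin hf)
  refine top_le_iff.1 (h.symm.le.trans
    (Submodule.topologicalClosure_mono (Submodule.span_mono ?_)))
  rintro _ ⟨k, rfl⟩
  exact ⟨k, f, rfl, by rw [zpow_natCast]⟩

end Translation

/-! ### Multiplicity one -/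

theorem not_isGeneratingFamily_empty {E : Type*} [NormedAddCommGroup E] [NormedSpace ℝ E]
    [Nontrivial E] (U : E ≃L[ℝ] E) : ¬ IsGeneratingFamily U ∅ := by
  intro h
  have hbot : (⊥ : Submodule ℝ E).topologicalClosure = ⊥ :=
    IsClosed.submodule_topologicalClosure_eq (by simp)
  simp [IsGeneratingFamily, orbitClosedSpan, hbot] at h

theorem operatorMultiplicity_eq_one {E : Type*} [NormedAddCommGroup E] [NormedSpace ℝ E]
    [Nontrivial E] {U : E ≃L[ℝ] E} {f : E} (hf : IsGeneratingFamily U {f}) :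
    operatorMultiplicity U = 1 := by
  refine le_antisymm ((iInf₂_le {f} hf).trans (Set.encard_singleton f).le) ?_
  refine le_iInf₂ fun F hF => Set.one_le_encard_iff_nonempty.2 ?_
  rw [Set.nonempty_iff_ne_empty]
  rintro rfl
  exact not_isGeneratingFamily_empty U hF

theorem mainTheorem11 {G : Type*} [CommGroup G] [TopologicalSpace G] [IsTopologicalGroup G]
    [CompactSpace G] [TopologicalSpace.MetrizableSpace G] [MeasurableSpace G] [BorelSpace G]
    (a : G) (hmin : IsMinimalHomeomorph (Homeomorph.mulLeft a)) :
    IsTopologicallySimple (Homeomorph.mulLeft a) ∧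
      ∀ f : C(G, ℝ), (∀ χ : PontryaginDual G, haarFourierCoeff f χ ≠ 0) →
        IsGeneratingFamily (compositionOperator (Homeomorph.mulLeft a)) {f} ∧
          Dense (Submodule.span ℝ
            (Set.range fun k : ℕ => (compositionOperator (Homeomorph.mulLeft a) ^ k) f) :
              Set C(G, ℝ)) := by
  have : SecondCountableTopology G := by
    let _ := TopologicalSpace.metrizableSpaceMetric G
    infer_instance
  refine ⟨?_, fun f hf => ⟨isGeneratingFamily_singleton_compositionOperator hmin hf,
    dense_span_range_compositionOperator_pow hmin hf⟩⟩
  obtain ⟨f, hf⟩ := exists_forall_haarFourierCoeff_ne_zero (G := G)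
  exact operatorMultiplicity_eq_one (isGeneratingFamily_singleton_compositionOperator hmin hf)
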